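/- Consider feedforward neural networks with $L$ hidden layers, input dimension $p_0=d_{\mathrm{in}}\ge 1$, output dimension $p_{L+1}=d_{\mathrm{out}}\ge1$ and hidden widths $p_1,\dots,p_L\ge 1$. For $0\le l\le L$ the weight from node $j\le p_l$ of layer $l$ to node $k\le p_{l+1}$ of layer $l+1$ is $$W^{(l+1)}_{jk}=\sqrt{\lambda^{(l)}_{p_l,j}}\;V^{(l+1)}_{jk},$$ where $V^{(l+1)}_{jk}\sim\mathcal N(0,\sigma_v^2)$ with $\sigma_v>0$ does not depend on the widths, $\lambda^{(0)}_{p_0,j}=1/d_{\mathrm{in}}$, and, for $1\le l\le L$, $\lambda^{(l)}_{p_l,j}\sim\mu^{(l)}_{p_l}$ for some probability distribution $\mu^{(l)}_{p_l}$ on $[0,\infty)$. The biases satisfy $B^{(l)}_k\sim\mathcal N(0,\sigma_b^2)$ with $\sigma_b\ge0$ ($B^{(l)}_k=0$ almost surely if $\sigma_b=0$). For every choice of the widths, all the variables $\lambda^{(l)}_{p_l,j}$ ($1\le l\le L$), $V^{(l)}_{jk}$ and $B^{(l)}_k$ of the network are mutually independent. A Lévy measure on $(0,\infty)$ is a Borel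 measure $\rho$ with $\int_0^\infty\min(1,x)\,\rho(dx)<\infty$; it is trivial if $\int_0^\infty\rho(dx)=0$. For $a\ge0$ and a Lévy measure $\rho$, $\mathrm{ID}(a,\rho)$ is the probability distribution on $[0,\infty)$ with Laplace transform $t\mapsto\exp\bigl(-ta-\int_0^\infty(1-e^{-wt})\,\rho(dw)\bigr)$, $t\ge0$. Let $l\in\{1,\dots,L\}$ and assume that, as $p_l\to\infty$, $$\sum_{j=1}^{p_l}\lambda^{(l)}_{p_l,j}\to\mathrm{ID}(a^{(l)},\rho^{(l)})\quad\text{in distribution}$$ for some $a^{(l)}\ge0$ and some Lévy measure $\rho^{(l)}$ on $(0,\infty)$. Then the following are equivalent: (i) $\rho^{(l)}$ is trivial; (ii) $\max_{1\le j\le p_l}\lambda^{(l)}_{p_l,j}\to0$ in probability as $p_l\to\infty$; (iii) for every node index $k\ge1$ of layer $l+1$ (that is, every $k\ge 1$ if $l<L$, and every $1\le k\le d_{\mathrm{out}}$ if $l=L$), $\max_{1\le j\le p_l}|W^{(l+1)}_{jk}|\to0$ in probability as $p_l\to\infty$. -/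

import Mathlib

open MeasureTheory ProbabilityTheory Filter Topology
open scoped NNReal ENNReal

/-- A Lévy measure on `(0, ∞)`: a Borel measure `ρ` carried by `(0, ∞)` with
`∫ min(1, x) ρ(dx) < ∞`. -/
structure IsLevyMeasure (ρ : Measure ℝ) : Prop where
  nonpos_null : ρ (Set.Iic 0) = 0
  lintegral_min_lt_top : ∫⁻ x, ENNReal.ofReal (min 1 x) ∂ρ < ∞

/-- A Lévy measure is trivial when `∫_{(0, ∞)} ρ(dw) = 0`. -/
def IsTrivialLevy (ρ : Measure ℝ) : Prop := ∫⁻ _ in Set.Ioi (0 : ℝ), 1 ∂ρ = 0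

/-- `θ = ID(a, ρ)`: the law on `[0, ∞)` whose Laplace transform is
`exp (-t a - ∫ (1 - exp (-w t)) ρ(dw))` for every `t ≥ 0`. -/
structure IsID (a : ℝ) (ρ : Measure ℝ) (θ : Measure ℝ) : Prop where
  isProbabilityMeasure : IsProbabilityMeasure θ
  neg_null : θ (Set.Iio 0) = 0
  laplace : ∀ t : ℝ, 0 ≤ t →
    ∫ x, Real.exp (-(t * x)) ∂θ
      = Real.exp (-(t * a) - ∫ w in Set.Ioi (0 : ℝ), (1 - Real.exp (-(w * t))) ∂ρ)

/-- `p` is a vector of layer widths `p 0 = din, p 1, …, p L, p (L + 1) = dout`, all at least 1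
(the values `p l` with `l > L + 1` play no role). -/
structure IsWidthVector (L din dout : ℕ) (p : ℕ → ℕ) : Prop where
  input : p 0 = din
  output : p (L + 1) = dout
  pos : ∀ l ≤ L + 1, 1 ≤ p l

/-- Labels of the elementary random variables of a network with `L` hidden layers and layer
widths `p`. Nodes within a layer are numbered from `0`.
* `nodeVar l h j` labels the variance of node `j` of the hidden layer `l`, `1 ≤ l ≤ L`;
* `gauss l h j k` labels the Gaussian factor of the weight between node `j` of layer `l` and
  node `k` of layer `l + 1`, `0 ≤ l ≤ L`;
* `bias l h k` labels the bias of node `k` of layer `l`, `1 ≤ l ≤ L + 1`. -/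
inductive NetIndex (L : ℕ) (p : ℕ → ℕ) : Type
  | nodeVar (l : ℕ) (h : 1 ≤ l ∧ l ≤ L) (j : Fin (p l)) : NetIndex L p
  | gauss (l : ℕ) (h : l ≤ L) (j : Fin (p l)) (k : Fin (p (l + 1))) : NetIndex L p
  | bias (l : ℕ) (h : 1 ≤ l ∧ l ≤ L + 1) (k : Fin (p l)) : NetIndex L p

/-- The random variable carried by a label. -/
def NetIndex.toRV {Ω : Type*} {L : ℕ} {p : ℕ → ℕ}
    (lam : (l n : ℕ) → Fin n → Ω → ℝ) (V : ℕ → ℕ → ℕ → Ω → ℝ) (B : ℕ → ℕ → Ω → ℝ) :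
    NetIndex L p → Ω → ℝ
  | .nodeVar l _ j => lam l (p l) j
  | .gauss l _ j k => V (l + 1) j k
  | .bias l _ k => B l k

/-- The random parameters of feedforward networks with `L` hidden layers, input dimension `din`
and output dimension `dout`, for all hidden widths at once:
* `lam l n j` is the variance of node `j` of layer `l` when that layer has width `n`;
* `V l j k` is the Gaussian factor of the weight from node `j` of layer `l - 1` to node `k` of
  layer `l`;
* `B l k` is the bias of node `k` of layer `l`.
Nothing is assumed on the joint law of the variances `lam l n j` for different widths `n`. -/
structure NetParams {Ω : Type*} [MeasurableSpace Ω] (P : Measure Ω) (L din dout : ℕ) where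
  din_pos : 1 ≤ din
  dout_pos : 1 ≤ dout
  /-- standard deviation of the Gaussian factors -/
  sigmaV : ℝ≥0
  sigmaV_pos : 0 < sigmaV
  /-- standard deviation of the biases, possibly zero -/
  sigmaB : ℝ≥0
  /-- the law on `[0, ∞)` of the node variances of layer `l` when it has width `n` -/
  nodeLaw : ℕ → ℕ → Measure ℝ
  nodeLaw_neg_null : ∀ l n, 1 ≤ l → l ≤ L → 1 ≤ n → nodeLaw l n (Set.Iio 0) = 0
  lam : (l n : ℕ) → Fin n → Ω → ℝ
  V : ℕ → ℕ → ℕ → Ω → ℝ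
  B : ℕ → ℕ → Ω → ℝ
  measurable_lam : ∀ l n j, Measurable (lam l n j)
  measurable_V : ∀ l j k, Measurable (V l j k)
  measurable_B : ∀ l k, Measurable (B l k)
  /-- the variances attached to the input nodes are `1 / din` -/
  lam_input : ∀ (j : Fin din) (ω : Ω), lam 0 din j ω = 1 / (din : ℝ)
  law_lam : ∀ l n, 1 ≤ l → l ≤ L → ∀ j : Fin n, P.map (lam l n j) = nodeLaw l n
  law_V : ∀ p, IsWidthVector L din dout p → ∀ l ≤ L, ∀ j < p l, ∀ k < p (l + 1),
    P.map (V (l + 1) j k) = gaussianReal 0 (sigmaV ^ 2)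
  law_B : ∀ p, IsWidthVector L din dout p → ∀ l, 1 ≤ l → l ≤ L + 1 → ∀ k < p l,
    P.map (B l k) = gaussianReal 0 (sigmaB ^ 2)
  /-- for every choice of the widths, the node variances, the Gaussian factors and the biases
  of the network are mutually independent -/
  indep : ∀ p, IsWidthVector L din dout p →
    iIndepFun (fun i : NetIndex L p => NetIndex.toRV lam V B i) P

/-- The weight `W^{(l+1)}_{jk} = √(λ^{(l)}_{n,j}) V^{(l+1)}_{jk}` from node `j` of layer `l`, of
width `n`, to node `k` of layer `l + 1`. -/
noncomputable def NetParams.weight {Ω : Type*} [MeasurableSpace Ω] {P : Measure Ω}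
    {L din dout : ℕ} (N : NetParams P L din dout) (l n : ℕ) (j : Fin n) (k : ℕ) (ω : Ω) : ℝ :=
  Real.sqrt (N.lam l n j ω) * N.V (l + 1) j k ω

/-!
Write `ν n` for the common law of the node variances of a layer of width `n`. By independence the
Laplace transform of their sum is the `n`-th power of that of `ν n`, so convergence of the sum to
`ID(a, ρ)` becomes convergence of exponents,
`n ∫ (1 - exp (-t x)) dν n → t a + ∫ (1 - exp (-t w)) ρ(dw)` for `t ≥ 0`. Twice this limit at
`t = 1` minus the limit at `t = 2` eliminates the drift:
`n ∫ (1 - exp (-x)) ^ 2 dν n → ∫ (1 - exp (-w)) ^ 2 ρ(dw)`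
(`IsNonnegIIDArray.tendsto_mul_integral_one_sub_exp_sq`), and the right-hand side vanishes exactly
when `ρ` is trivial (`IsLevyMeasure.isTrivialLevy_iff`).

The implications (i) → (iii) → (ii) → (i) then go as follows.

* If `ρ` is trivial, a Markov bound with fourth moments of the Gaussian factors gives
  `P (|W j k| ≥ ε) ≤ C ε * ∫ (1 - exp (-x)) ^ 2 dν n`, and a union bound over the `n` nodes
  concludes (`IsNonnegIIDArray.tendstoInMeasure_iSup_abs_sqrt_mul`).
* If the largest weight tends to `0`, then for independent events with equal probabilities `q n`
  whose union becomes negligible one has `n q n → 0`. Applied to the events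
  `{λ j ≥ ε, |V j k| ≥ 1}`, this gives `n ν n [ε, ∞) → 0`, hence the largest variance tends to `0`
  (`IsNonnegIIDArray.tendsto_mul_tail_of_tendstoInMeasure_iSup_abs_sqrt_mul`).
* If the largest variance tends to `0`, again `n ν n [ε, ∞) → 0`. Only values below `ε` contribute
  to the limit of `n ∫ (1 - exp (-x)) ^ 2 dν n`, which is therefore at most
  `(1 - exp (-ε)) lim n ∫ (1 - exp (-x)) dν n`; letting `ε → 0`, it vanishes
  (`IsNonnegIIDArray.isTrivialLevy_of_tendsto_mul_tail`).
-/

/-! ### Elementary estimates -/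

/-- If `x n ^ n → exp (-c)` with `x n` eventually positive, then `n (1 - x n) → c`: with `u = -log (x n)` one
has `n u → c`, hence `x n → 1`, and `x u ≤ 1 - x ≤ u`. -/
lemma tendsto_mul_one_sub_of_tendsto_pow {x : ℕ → ℝ} {c : ℝ}
    (hpos : ∀ᶠ n in atTop, 0 < x n)
    (h : Tendsto (fun n => x n ^ n) atTop (𝓝 (Real.exp (-c)))) :
    Tendsto (fun n : ℕ => (n : ℝ) * (1 - x n)) atTop (𝓝 c) := by
  have hlog : Tendsto (fun n : ℕ => (n : ℝ) * (-Real.log (x n))) atTop (𝓝 c) := by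
    have h1 := (Tendsto.log h (Real.exp_pos _).ne').neg
    rw [Real.log_exp, neg_neg] at h1
    refine h1.congr fun n => ?_
    rw [Real.log_pow]; ring
  have hu : Tendsto (fun n : ℕ => -Real.log (x n)) atTop (𝓝 0) := by
    have h1 := hlog.mul (tendsto_inv_atTop_nhds_zero_nat (𝕜 := ℝ))
    rw [mul_zero] at h1
    refine h1.congr' ?_
    filter_upwards [eventually_ge_atTop 1] with n hn
    have : (n : ℝ) ≠ 0 := by positivity
    field_simp
  have hx : Tendsto x atTop (𝓝 1) := by
    have h1 := (Real.continuous_exp.tendsto _).comp hu.neg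
    rw [neg_zero, Real.exp_zero] at h1
    refine h1.congr' ?_
    filter_upwards [hpos] with n hn
    simp [Real.exp_log hn]
  have hlow : Tendsto (fun n : ℕ => x n * ((n : ℝ) * (-Real.log (x n)))) atTop (𝓝 c) := by
    simpa using hx.mul hlog
  refine tendsto_of_tendsto_of_tendsto_of_le_of_le' hlow hlog ?_ ?_
  · filter_upwards [hpos] with n hn
    have h1 : -Real.log (x n) ≤ (x n)⁻¹ - 1 := by
      rw [← Real.log_inv]; exact Real.log_le_sub_one_of_pos (inv_pos.2 hn)
    have h2 : x n * (-Real.log (x n)) ≤ 1 - x n := by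
      calc x n * (-Real.log (x n)) ≤ x n * ((x n)⁻¹ - 1) := by gcongr
        _ = 1 - x n := by field_simp
    calc x n * ((n : ℝ) * (-Real.log (x n))) = n * (x n * (-Real.log (x n))) := by ring
      _ ≤ n * (1 - x n) := by gcongr
  · filter_upwards [hpos] with n hn
    have := Real.log_le_sub_one_of_pos hn
    gcongr
    linarith

lemma min_one_le_two_mul_one_sub_exp_neg {x : ℝ} (hx : 0 ≤ x) :
    min 1 x ≤ 2 * (1 - Real.exp (-x)) := by
  have h1 : Real.exp (-x) ≤ (1 + x)⁻¹ := by
    rw [Real.exp_neg]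
    gcongr
    linarith [Real.add_one_le_exp x]
  have h2 : min 1 x ≤ 2 * (1 - (1 + x)⁻¹) := by
    have h3 : 2 * (1 - (1 + x)⁻¹) = 2 * x / (1 + x) := by
      field_simp; ring
    rw [h3, le_div_iff₀ (by linarith)]
    rcases le_total 1 x with h | h
    · rw [min_eq_left h]; linarith
    · rw [min_eq_right h]; nlinarith
  linarith

/-- The deterministic inequality behind the fourth-moment Markov bound for a weight `√x v`. -/
lemma min_one_pow_four_le_of_le_abs_sqrt_mul {x v ε : ℝ} (hx : 0 ≤ x) (hε : 0 ≤ ε)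
    (h : ε ≤ |Real.sqrt x * v|) :
    min 1 (ε ^ 4) ≤ 4 * ((1 - Real.exp (-x)) ^ 2 * (1 + v ^ 4)) := by
  have h1 : min 1 (ε ^ 4) ≤ (min 1 x) ^ 2 * (1 + v ^ 4) := by
    rcases le_total 1 x with h1 | h1
    · rw [min_eq_left h1]
      have : 0 ≤ v ^ 4 := by positivity
      exact (min_le_left _ _).trans (by linarith)
    · rw [min_eq_right h1]
      refine (min_le_right _ _).trans ?_
      have h2 : ε ^ 4 ≤ |Real.sqrt x * v| ^ 4 := by gcongr
      have h3 : |Real.sqrt x * v| ^ 4 = x ^ 2 * v ^ 4 := by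
        rw [(by decide : Even 4).pow_abs, mul_pow]
        congr 1
        rw [show (4 : ℕ) = 2 * 2 from rfl, pow_mul, Real.sq_sqrt hx]
      nlinarith [sq_nonneg x]
  have h4 : (min 1 x) ^ 2 ≤ (2 * (1 - Real.exp (-x))) ^ 2 :=
    pow_le_pow_left₀ (le_min zero_le_one hx) (min_one_le_two_mul_one_sub_exp_neg hx) 2
  calc min 1 (ε ^ 4) ≤ (min 1 x) ^ 2 * (1 + v ^ 4) := h1
    _ ≤ (2 * (1 - Real.exp (-x))) ^ 2 * (1 + v ^ 4) := by gcongr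
    _ = _ := by ring

/-! ### Lévy measures -/

lemma IsLevyMeasure.integrableOn_min_one {ρ : Measure ℝ} (hρ : IsLevyMeasure ρ) :
    IntegrableOn (fun w => min 1 w) (Set.Ioi 0) ρ := by
  refine ⟨by fun_prop, ?_⟩
  rw [hasFiniteIntegral_iff_ofReal]
  · exact (setLIntegral_le_lintegral _ _).trans_lt hρ.lintegral_min_lt_top
  · filter_upwards [ae_restrict_mem measurableSet_Ioi] with w hw
    exact le_min zero_le_one (le_of_lt hw)

lemma IsLevyMeasure.integrableOn_one_sub_exp {ρ : Measure ℝ} (hρ : IsLevyMeasure ρ) {t : ℝ}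
    (ht : 0 ≤ t) : IntegrableOn (fun w => 1 - Real.exp (-(w * t))) (Set.Ioi 0) ρ := by
  refine (hρ.integrableOn_min_one.const_mul (max 1 t)).mono' (by fun_prop) ?_
  filter_upwards [ae_restrict_mem measurableSet_Ioi] with w hw
  have hw : 0 < w := hw
  have h0 : Real.exp (-(w * t)) ≤ 1 := Real.exp_le_one_iff.2 (by nlinarith)
  rw [Real.norm_of_nonneg (by linarith)]
  have h1 : 1 - Real.exp (-(w * t)) ≤ w * t := by
    linarith [Real.add_one_le_exp (-(w * t))]
  have h2 := Real.exp_pos (-(w * t))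
  rcases le_total 1 w with h | h
  · rw [min_eq_left h]
    linarith [le_max_left 1 t]
  · rw [min_eq_right h]
    nlinarith [le_max_right 1 t]

lemma IsLevyMeasure.integrableOn_one_sub_exp_sq {ρ : Measure ℝ} (hρ : IsLevyMeasure ρ) :
    IntegrableOn (fun w => (1 - Real.exp (-w)) ^ 2) (Set.Ioi 0) ρ := by
  refine (((hρ.integrableOn_one_sub_exp zero_le_one).const_mul 2).sub
    (hρ.integrableOn_one_sub_exp zero_le_two)).congr (ae_of_all _ fun w => ?_)
  have : Real.exp (-(w * 2)) = Real.exp (-w) ^ 2 := by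
    rw [← Real.exp_nat_mul]; congr 1; push_cast; ring
  simp only [Pi.sub_apply, mul_one, this]
  ring

lemma IsLevyMeasure.two_mul_integral_sub_integral {ρ : Measure ℝ} (hρ : IsLevyMeasure ρ) :
    2 * ∫ w in Set.Ioi (0 : ℝ), (1 - Real.exp (-(w * 1))) ∂ρ
      - ∫ w in Set.Ioi (0 : ℝ), (1 - Real.exp (-(w * 2))) ∂ρ
      = ∫ w in Set.Ioi (0 : ℝ), (1 - Real.exp (-w)) ^ 2 ∂ρ := by
  rw [← integral_const_mul, ← integral_sub
    ((hρ.integrableOn_one_sub_exp zero_le_one).const_mul 2)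
    (hρ.integrableOn_one_sub_exp zero_le_two)]
  refine integral_congr_ae (ae_of_all _ fun w => ?_)
  have : Real.exp (-(w * 2)) = Real.exp (-w) ^ 2 := by
    rw [← Real.exp_nat_mul]; congr 1; push_cast; ring
  simp only [mul_one, this]
  ring

lemma IsLevyMeasure.isTrivialLevy_iff {ρ : Measure ℝ} (hρ : IsLevyMeasure ρ) :
    IsTrivialLevy ρ ↔ ∫ w in Set.Ioi (0 : ℝ), (1 - Real.exp (-w)) ^ 2 ∂ρ = 0 := by
  rw [IsTrivialLevy, setLIntegral_one]
  refine ⟨fun h => by rw [Measure.restrict_eq_zero.2 h, integral_zero_measure], fun h => ?_⟩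
  rw [integral_eq_zero_iff_of_nonneg (fun w => sq_nonneg _) hρ.integrableOn_one_sub_exp_sq] at h
  rw [← Measure.restrict_eq_zero, ← ae_eq_bot, ← Filter.eventually_false_iff_eq_bot]
  filter_upwards [h, ae_restrict_mem measurableSet_Ioi] with w hw hw0
  have h1 : Real.exp (-w) < 1 := Real.exp_lt_one_iff.2 (by simpa using hw0)
  have h2 : 1 - Real.exp (-w) = 0 := pow_eq_zero_iff two_ne_zero |>.1 hw
  linarith

/-! ### Independent events -/

lemma iIndepSet.measureReal_iInter_compl {Ω ι : Type*} [MeasurableSpace Ω] [Fintype ι]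
    {P : Measure Ω} [IsProbabilityMeasure P] {A : ι → Set Ω} (hA : ∀ i, MeasurableSet (A i))
    (h : iIndepSet A P) : P.real (⋂ i, (A i)ᶜ) = ∏ i, (1 - P.real (A i)) := by
  have h1 : P (⋂ i, (A i)ᶜ) = ∏ i, P (A i)ᶜ := by
    refine ((iIndepSet_iff_iIndep _ _).1 h).meas_iInter fun i => ?_
    exact (MeasurableSpace.measurableSet_generateFrom (by simp)).compl
  rw [measureReal_def, h1, ENNReal.toReal_prod]
  refine Finset.prod_congr rfl fun i _ => ?_
  rw [← measureReal_def, probReal_compl_eq_one_sub (hA i)]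

/-- In a triangular array of independent events with equal probabilities `q n` in row `n`, if the
union of row `n` becomes negligible, then `n q n → 0`. -/
lemma tendsto_mul_zero_of_tendsto_measureReal_iUnion {Ω : Type*} [MeasurableSpace Ω]
    {P : Measure Ω} [IsProbabilityMeasure P] {A : (n : ℕ) → Fin n → Set Ω} {q : ℕ → ℝ}
    (hA : ∀ n j, MeasurableSet (A n j)) (hind : ∀ n, 1 ≤ n → iIndepSet (A n) P)
    (hq : ∀ n, 1 ≤ n → ∀ j, P.real (A n j) = q n)
    (h : Tendsto (fun n => P.real (⋃ j, A n j)) atTop (𝓝 0)) :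
    Tendsto (fun n : ℕ => (n : ℝ) * q n) atTop (𝓝 0) := by
  have hpow : Tendsto (fun n => (1 - q n) ^ n) atTop (𝓝 (Real.exp (-0))) := by
    have h1 : Tendsto (fun n => 1 - P.real (⋃ j, A n j)) atTop (𝓝 (Real.exp (-0))) := by
      simpa using h.const_sub 1
    refine h1.congr' ?_
    filter_upwards [eventually_ge_atTop 1] with n hn
    rw [← probReal_compl_eq_one_sub (MeasurableSet.iUnion (hA n)), Set.compl_iUnion,
      iIndepSet.measureReal_iInter_compl (hA n) (hind n hn)]
    simp [hq n hn]
  have hpos : ∀ᶠ n in atTop, 0 < 1 - q n := by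
    have h1 : ∀ᶠ n in atTop, 0 < (1 - q n) ^ n :=
      hpow.eventually_const_lt (Real.exp_pos _)
    filter_upwards [h1, eventually_ge_atTop 1] with n hn hn1
    have hle : 0 ≤ 1 - q n := by
      rw [← hq n hn1 ⟨0, hn1⟩]; linarith [measureReal_le_one (μ := P) (s := A n ⟨0, hn1⟩)]
    refine lt_of_le_of_ne hle fun h0 => ?_
    rw [← h0, zero_pow (by omega)] at hn
    exact lt_irrefl _ hn
  simpa using tendsto_mul_one_sub_of_tendsto_pow hpos hpow

lemma measureReal_iUnion_fin_le {Ω : Type*} [MeasurableSpace Ω] {P : Measure Ω}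
    [IsProbabilityMeasure P] {n : ℕ} {A : Fin n → Set Ω} {q : ℝ} (hq : ∀ j, P.real (A j) ≤ q) :
    P.real (⋃ j, A j) ≤ n * q := by
  calc P.real (⋃ j, A j) ≤ ∑ j, P.real (A j) := measureReal_iUnion_fintype_le _
    _ ≤ ∑ _j : Fin n, q := Finset.sum_le_sum fun j _ => hq j
    _ = n * q := by simp

/-- If the variables `X j` and `Y j`, `j ∈ ι`, are mutually independent, then so are the events
`{X j ∈ s} ∩ {Y j ∈ t}`. -/
lemma iIndepFun.iIndepSet_preimage_inter_preimage {Ω ι : Type*} [MeasurableSpace Ω]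
    {P : Measure Ω} {X Y : ι → Ω → ℝ} (hX : ∀ j, Measurable (X j)) (hY : ∀ j, Measurable (Y j))
    (h : iIndepFun (Sum.elim X Y) P) {s t : Set ℝ} (hs : MeasurableSet s) (ht : MeasurableSet t) :
    iIndepSet (fun j => X j ⁻¹' s ∩ Y j ⁻¹' t) P := by
  rw [iIndepSet_iff_meas_biInter fun j => (hX j hs).inter (hY j ht)]
  have key : ∀ u v : Finset ι, P ((⋂ j ∈ u, X j ⁻¹' s) ∩ ⋂ j ∈ v, Y j ⁻¹' t)
      = (∏ j ∈ u, P (X j ⁻¹' s)) * ∏ j ∈ v, P (Y j ⁻¹' t) := by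
    intro u v
    have h1 := h.measure_inter_preimage_eq_mul (u.disjSum v)
      (sets := Sum.elim (fun _ => s) (fun _ => t)) (by rintro (j | j) _ <;> simpa)
    rw [Finset.prod_disjSum] at h1
    simp only [Sum.elim_inl, Sum.elim_inr] at h1
    rw [← h1]
    congr 1
    ext ω
    simp
  intro u
  have h2 : ∀ j, P (X j ⁻¹' s ∩ Y j ⁻¹' t) = P (X j ⁻¹' s) * P (Y j ⁻¹' t) := by
    intro j
    simpa using key {j} {j}
  simp_rw [h2, Finset.prod_mul_distrib, Set.iInter_inter_distrib]
  exact key u u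

/-! ### Triangular arrays with i.i.d. nonnegative rows -/

/-- A triangular array whose `n`-th row, `1 ≤ n`, consists of `n` independent variables with the
common law `ν n`, carried by `[0, ∞)`. Nothing is required of the joint law of different rows. -/
structure IsNonnegIIDArray {Ω : Type*} [MeasurableSpace Ω] (P : Measure Ω)
    (X : (n : ℕ) → Fin n → Ω → ℝ) (ν : ℕ → Measure ℝ) : Prop where
  measurable : ∀ n j, Measurable (X n j)
  indep : ∀ n, 1 ≤ n → iIndepFun (X n) P
  law : ∀ n, 1 ≤ n → ∀ j, P.map (X n j) = ν n
  neg_null : ∀ n, 1 ≤ n → ν n (Set.Iio 0) = 0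

namespace IsNonnegIIDArray

variable {Ω : Type*} [MeasurableSpace Ω] {P : Measure Ω}
  {X : (n : ℕ) → Fin n → Ω → ℝ} {ν : ℕ → Measure ℝ}

lemma ae_nonneg_law (h : IsNonnegIIDArray P X ν) {n : ℕ} (hn : 1 ≤ n) : ∀ᵐ x ∂ν n, 0 ≤ x := by
  rw [ae_iff]
  simpa [Set.Iio] using h.neg_null n hn

lemma ae_nonneg (h : IsNonnegIIDArray P X ν) {n : ℕ} (hn : 1 ≤ n) :
    ∀ᵐ ω ∂P, ∀ j, 0 ≤ X n j ω := by
  rw [ae_all_iff]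
  intro j
  have h1 := h.ae_nonneg_law hn
  rw [← h.law n hn j] at h1
  exact ae_of_ae_map (h.measurable n j).aemeasurable h1

/-- The Laplace transform of the sum of a row is a power of that of a single entry. -/
lemma integral_exp_sum (h : IsNonnegIIDArray P X ν) {n : ℕ} (hn : 1 ≤ n) (t : ℝ) :
    ∫ ω, Real.exp (-(t * ∑ j, X n j ω)) ∂P = (∫ x, Real.exp (-(t * x)) ∂ν n) ^ n := by
  have h1 := (h.indep n hn).mgf_sum (t := -t) (h.measurable n) Finset.univ
  have h2 : ∀ j, mgf (X n j) P (-t) = ∫ x, Real.exp (-(t * x)) ∂ν n := by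
    intro j
    rw [← h.law n hn j, integral_map (h.measurable n j).aemeasurable (by fun_prop)]
    simp [mgf]
  rw [Finset.prod_congr rfl fun j _ => h2 j] at h1
  simpa [mgf] using h1

variable [IsProbabilityMeasure P]

lemma isProbabilityMeasure (h : IsNonnegIIDArray P X ν) {n : ℕ} (hn : 1 ≤ n) :
    IsProbabilityMeasure (ν n) := by
  rw [← h.law n hn ⟨0, hn⟩]
  exact Measure.isProbabilityMeasure_map (h.measurable n _).aemeasurable

lemma integrable_exp (h : IsNonnegIIDArray P X ν) {n : ℕ} (hn : 1 ≤ n) {t : ℝ} (ht : 0 ≤ t) :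
    Integrable (fun x => Real.exp (-(t * x))) (ν n) := by
  have := h.isProbabilityMeasure hn
  refine (integrable_const (1 : ℝ)).mono' (by fun_prop) ?_
  filter_upwards [h.ae_nonneg_law hn] with x hx
  rw [Real.norm_of_nonneg (Real.exp_pos _).le, Real.exp_le_one_iff]
  nlinarith

lemma integrable_one_sub_exp (h : IsNonnegIIDArray P X ν) {n : ℕ} (hn : 1 ≤ n) {t : ℝ}
    (ht : 0 ≤ t) : Integrable (fun x => 1 - Real.exp (-(t * x))) (ν n) :=
  have := h.isProbabilityMeasure hn
  (integrable_const _).sub (h.integrable_exp hn ht)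

lemma integrable_one_sub_exp_sq (h : IsNonnegIIDArray P X ν) {n : ℕ} (hn : 1 ≤ n) :
    Integrable (fun x => (1 - Real.exp (-x)) ^ 2) (ν n) := by
  have := h.isProbabilityMeasure hn
  refine (integrable_const (1 : ℝ)).mono' (by fun_prop) ?_
  filter_upwards [h.ae_nonneg_law hn] with x hx
  have h1 : Real.exp (-x) ≤ 1 := Real.exp_le_one_iff.2 (by linarith)
  have h2 := Real.exp_pos (-x)
  rw [Real.norm_of_nonneg (sq_nonneg _)]
  nlinarith

section Limit

variable {Ω' : Type*} [MeasurableSpace Ω'] {P' : Measure Ω'} [IsProbabilityMeasure P']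
  {S : Ω' → ℝ} {a : ℝ} {ρ : Measure ℝ}

lemma tendsto_integral_exp_sum (h : IsNonnegIIDArray P X ν) (hS : IsID a ρ (P'.map S))
    (hconv : TendstoInDistribution (fun (n : ℕ) (ω : Ω) => ∑ j : Fin n, X n j ω)
      atTop S (fun _ => P) P') {t : ℝ} (ht : 0 ≤ t) :
    Tendsto (fun n => ∫ ω, Real.exp (-(t * ∑ j : Fin n, X n j ω)) ∂P) atTop
      (𝓝 (∫ x, Real.exp (-(t * x)) ∂(P'.map S))) := by
  -- `exp (-t x)` is unbounded on the negative half-line, which carries no mass: truncate there.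
  let f : BoundedContinuousFunction ℝ ℝ :=
    BoundedContinuousFunction.ofNormedAddCommGroup (fun x => Real.exp (-(t * max x 0)))
      (by fun_prop) 1 (fun x => by
        rw [Real.norm_of_nonneg (Real.exp_pos _).le, Real.exp_le_one_iff]
        have := mul_nonneg ht (le_max_right x 0)
        linarith)
  have hf : ∀ x, f x = Real.exp (-(t * max x 0)) := fun _ => rfl
  have h1 := ProbabilityMeasure.tendsto_iff_forall_integral_tendsto.1 hconv.tendsto f
  simp only [ProbabilityMeasure.coe_mk] at h1
  have hlim : ∫ x, f x ∂(P'.map S) = ∫ x, Real.exp (-(t * x)) ∂(P'.map S) := by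
    refine integral_congr_ae ?_
    have h0 : ∀ᵐ x ∂(P'.map S), 0 ≤ x := by
      rw [ae_iff]
      simpa [Set.Iio] using hS.neg_null
    filter_upwards [h0] with x hx
    rw [hf, max_eq_left hx]
  rw [hlim] at h1
  refine h1.congr' ?_
  filter_upwards [eventually_ge_atTop 1] with n hn
  rw [integral_map (hconv.forall_aemeasurable n) (by fun_prop)]
  refine integral_congr_ae ?_
  filter_upwards [h.ae_nonneg hn] with ω hω
  rw [hf, max_eq_left (Finset.sum_nonneg fun j _ => hω j)]

/-- Convergence of the Laplace exponents: the rescaled laws `n ν n`, tested against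
`1 - exp (-t x)`, converge to the Laplace exponent of the limit law. -/
lemma tendsto_mul_integral_one_sub_exp (h : IsNonnegIIDArray P X ν) (hS : IsID a ρ (P'.map S))
    (hconv : TendstoInDistribution (fun (n : ℕ) (ω : Ω) => ∑ j : Fin n, X n j ω)
      atTop S (fun _ => P) P') {t : ℝ} (ht : 0 ≤ t) :
    Tendsto (fun n : ℕ => (n : ℝ) * ∫ x, (1 - Real.exp (-(t * x))) ∂ν n) atTop
      (𝓝 (t * a + ∫ w in Set.Ioi (0 : ℝ), (1 - Real.exp (-(w * t))) ∂ρ)) := by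
  have h1 := h.tendsto_integral_exp_sum hS hconv ht
  rw [hS.laplace t ht, ← neg_add'] at h1
  have h2 : Tendsto (fun n => (∫ x, Real.exp (-(t * x)) ∂ν n) ^ n) atTop
      (𝓝 (Real.exp (-(t * a + ∫ w in Set.Ioi (0 : ℝ), (1 - Real.exp (-(w * t))) ∂ρ)))) := by
    refine h1.congr' ?_
    filter_upwards [eventually_ge_atTop 1] with n hn
    exact h.integral_exp_sum hn t
  have hpos : ∀ᶠ n in atTop, 0 < ∫ x, Real.exp (-(t * x)) ∂ν n := by
    filter_upwards [eventually_ge_atTop 1] with n hn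
    have := h.isProbabilityMeasure hn
    exact integral_exp_pos (h.integrable_exp hn ht)
  refine (tendsto_mul_one_sub_of_tendsto_pow hpos h2).congr' ?_
  filter_upwards [eventually_ge_atTop 1] with n hn
  have := h.isProbabilityMeasure hn
  rw [integral_sub (integrable_const _) (h.integrable_exp hn ht)]
  simp

/-- The test function `(1 - exp (-x)) ^ 2` is a combination of Laplace test functions which does
not see the drift `a`: its limit only involves the Lévy measure. -/
lemma tendsto_mul_integral_one_sub_exp_sq (h : IsNonnegIIDArray P X ν)
    (hρ : IsLevyMeasure ρ) (hS : IsID a ρ (P'.map S))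
    (hconv : TendstoInDistribution (fun (n : ℕ) (ω : Ω) => ∑ j : Fin n, X n j ω)
      atTop S (fun _ => P) P') :
    Tendsto (fun n : ℕ => (n : ℝ) * ∫ x, (1 - Real.exp (-x)) ^ 2 ∂ν n) atTop
      (𝓝 (∫ w in Set.Ioi (0 : ℝ), (1 - Real.exp (-w)) ^ 2 ∂ρ)) := by
  have h1 := ((h.tendsto_mul_integral_one_sub_exp hS hconv zero_le_one).const_mul 2).sub
    (h.tendsto_mul_integral_one_sub_exp hS hconv zero_le_two)
  rw [show ∀ x y : ℝ, 2 * (1 * a + x) - (2 * a + y) = 2 * x - y from fun x y => by ring,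
    hρ.two_mul_integral_sub_integral] at h1
  refine h1.congr' ?_
  filter_upwards [eventually_ge_atTop 1] with n hn
  rw [show ∀ x y : ℝ, 2 * ((n : ℝ) * x) - n * y = n * (2 * x - y) from fun x y => by ring,
    ← integral_const_mul, ← integral_sub ((h.integrable_one_sub_exp hn zero_le_one).const_mul 2)
      (h.integrable_one_sub_exp hn zero_le_two)]
  congr 1
  refine integral_congr_ae (ae_of_all _ fun x => ?_)
  have : Real.exp (-(2 * x)) = Real.exp (-x) ^ 2 := by
    rw [← Real.exp_nat_mul]; congr 1; push_cast; ring
  simp only [one_mul, this]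
  ring

/-- If `n ν n [ε, ∞) → 0` for every `ε > 0`, the Lévy measure of the limit is trivial: below `ε`
one has `(1 - exp (-x)) ^ 2 ≤ (1 - exp (-ε)) (1 - exp (-x))`, and `n ∫ (1 - exp (-x)) dν n` stays
bounded. -/
lemma isTrivialLevy_of_tendsto_mul_tail (h : IsNonnegIIDArray P X ν)
    (hρ : IsLevyMeasure ρ) (hS : IsID a ρ (P'.map S))
    (hconv : TendstoInDistribution (fun (n : ℕ) (ω : Ω) => ∑ j : Fin n, X n j ω)
      atTop S (fun _ => P) P')
    (htail : ∀ ε : ℝ, 0 < ε →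
      Tendsto (fun n : ℕ => (n : ℝ) * (ν n).real (Set.Ici ε)) atTop (𝓝 0)) :
    IsTrivialLevy ρ := by
  rw [hρ.isTrivialLevy_iff]
  set c := 1 * a + ∫ w in Set.Ioi (0 : ℝ), (1 - Real.exp (-(w * 1))) ∂ρ
  have hsq := h.tendsto_mul_integral_one_sub_exp_sq hρ hS hconv
  have hle : ∀ ε : ℝ, 0 < ε →
      ∫ w in Set.Ioi (0 : ℝ), (1 - Real.exp (-w)) ^ 2 ∂ρ ≤ (1 - Real.exp (-ε)) * c := by
    intro ε hε
    have hlim := (htail ε hε).add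
      ((h.tendsto_mul_integral_one_sub_exp hS hconv zero_le_one).const_mul (1 - Real.exp (-ε)))
    rw [zero_add] at hlim
    refine le_of_tendsto_of_tendsto hsq hlim ?_
    filter_upwards [eventually_ge_atTop 1] with n hn
    have := h.isProbabilityMeasure hn
    rw [mul_left_comm, ← mul_add]
    gcongr
    have hind : Integrable ((Set.Ici ε).indicator (1 : ℝ → ℝ)) (ν n) :=
      (integrable_const (1 : ℝ)).indicator measurableSet_Ici
    rw [← integral_indicator_one measurableSet_Ici, ← integral_const_mul, ← integral_add hind
      ((h.integrable_one_sub_exp hn zero_le_one).const_mul _)]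
    refine integral_mono_ae (h.integrable_one_sub_exp_sq hn)
      (hind.add ((h.integrable_one_sub_exp hn zero_le_one).const_mul _)) ?_
    filter_upwards [h.ae_nonneg_law hn] with x hx
    have h1 : Real.exp (-x) ≤ 1 := Real.exp_le_one_iff.2 (by linarith)
    have h2 : Real.exp (-ε) ≤ 1 := Real.exp_le_one_iff.2 (by linarith)
    have h3 := Real.exp_pos (-x)
    simp only [one_mul]
    by_cases hxε : ε ≤ x
    · rw [Set.indicator_of_mem (by exact hxε)]
      simp only [Pi.one_apply]
      nlinarith
    · rw [Set.indicator_of_notMem (by exact hxε), zero_add, sq]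
      have : Real.exp (-ε) ≤ Real.exp (-x) := Real.exp_le_exp.2 (by linarith)
      exact mul_le_mul_of_nonneg_right (by linarith) (by linarith)
  refine le_antisymm ?_ (integral_nonneg fun _ => sq_nonneg _)
  have hlim : Tendsto (fun ε : ℝ => (1 - Real.exp (-ε)) * c) (𝓝[>] 0) (𝓝 0) := by
    have : Tendsto (fun ε : ℝ => (1 - Real.exp (-ε)) * c) (𝓝 0)
        (𝓝 ((1 - Real.exp (-0)) * c)) := by
      apply Continuous.tendsto
      fun_prop
    simpa using this.mono_left nhdsWithin_le_nhds
  refine ge_of_tendsto hlim ?_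
  filter_upwards [self_mem_nhdsWithin] with ε hε
  exact hle ε hε

end Limit

/-- The maximum of the rows tends to `0` in probability if the tails satisfy
`n ν n [ε, ∞) → 0`. -/
lemma tendstoInMeasure_iSup (h : IsNonnegIIDArray P X ν)
    (htail : ∀ ε : ℝ, 0 < ε →
      Tendsto (fun n : ℕ => (n : ℝ) * (ν n).real (Set.Ici ε)) atTop (𝓝 0)) :
    TendstoInMeasure P (fun (n : ℕ) (ω : Ω) => ⨆ j : Fin n, X n j ω) atTop
      (fun _ => (0 : ℝ)) := by
  rw [tendstoInMeasure_iff_measureReal_norm]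
  intro ε hε
  refine squeeze_zero' (Eventually.of_forall fun n => measureReal_nonneg) ?_ (htail ε hε)
  filter_upwards [eventually_ge_atTop 1] with n hn
  have hsub : P.real {ω | ε ≤ ‖(⨆ j : Fin n, X n j ω) - 0‖}
      ≤ P.real (⋃ j, X n j ⁻¹' Set.Ici ε) := by
    refine ENNReal.toReal_mono (measure_ne_top _ _) (measure_mono_ae ?_)
    filter_upwards [h.ae_nonneg hn] with ω hω hmem
    have : Nonempty (Fin n) := ⟨⟨0, hn⟩⟩
    have hmem : ε ≤ ‖(⨆ j : Fin n, X n j ω) - 0‖ := hmem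
    rw [sub_zero, Real.norm_of_nonneg (Real.iSup_nonneg hω)] at hmem
    obtain ⟨j, hj⟩ := exists_eq_ciSup_of_finite (f := fun j : Fin n => X n j ω)
    exact Set.mem_iUnion.2 ⟨j, by simpa [hj] using hmem⟩
  refine hsub.trans (measureReal_iUnion_fin_le fun j => ?_)
  rw [← h.law n hn j, map_measureReal_apply (h.measurable n j) measurableSet_Ici]

/-- Converse of `tendstoInMeasure_iSup`. -/
lemma tendsto_mul_tail_of_tendstoInMeasure_iSup (h : IsNonnegIIDArray P X ν)
    (hmax : TendstoInMeasure P (fun (n : ℕ) (ω : Ω) => ⨆ j : Fin n, X n j ω) atTop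
      (fun _ => (0 : ℝ))) {ε : ℝ} (hε : 0 < ε) :
    Tendsto (fun n : ℕ => (n : ℝ) * (ν n).real (Set.Ici ε)) atTop (𝓝 0) := by
  rw [tendstoInMeasure_iff_measureReal_norm] at hmax
  refine tendsto_mul_zero_of_tendsto_measureReal_iUnion (P := P)
    (A := fun n j => X n j ⁻¹' Set.Ici ε) (fun n j => h.measurable n j measurableSet_Ici) ?_ ?_ ?_
  · intro n hn
    rw [iIndepSet_iff_meas_biInter fun j => h.measurable n j measurableSet_Ici]
    intro s
    exact (h.indep n hn).measure_inter_preimage_eq_mul s fun _ _ => measurableSet_Ici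
  · intro n hn j
    rw [← h.law n hn j, map_measureReal_apply (h.measurable n j) measurableSet_Ici]
  · refine squeeze_zero (fun n => measureReal_nonneg) (fun n => measureReal_mono ?_) (hmax ε hε)
    refine Set.iUnion_subset fun j ω hω => ?_
    have h1 : X n j ω ≤ ⨆ j : Fin n, X n j ω :=
      le_ciSup (f := fun j : Fin n => X n j ω) (Set.finite_range _).bddAbove j
    have hω : ε ≤ X n j ω := hω
    simpa using (hω.trans h1).trans (le_abs_self _)

/-! ### Gaussian multiples of the entries -/

section Weights

variable {V : ℕ → Ω → ℝ} {s : ℝ≥0}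

/-- Fourth-moment Markov bound, uniform over the entries of a row. -/
lemma measureReal_le_abs_sqrt_mul_le (h : IsNonnegIIDArray P X ν)
    (hV : ∀ j, Measurable (V j)) (hlawV : ∀ j, P.map (V j) = gaussianReal 0 s)
    {n : ℕ} (hn : 1 ≤ n) (hind : ∀ j : Fin n, IndepFun (X n j) (V j) P) {ε : ℝ} (hε : 0 < ε)
    (j : Fin n) :
    P.real {ω | ε ≤ |Real.sqrt (X n j ω) * V j ω|}
      ≤ 4 * (∫ v, (1 + v ^ 4) ∂gaussianReal 0 s) / min 1 (ε ^ 4)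
        * ∫ x, (1 - Real.exp (-x)) ^ 2 ∂ν n := by
  have hmin : 0 < min 1 (ε ^ 4) := lt_min one_pos (by positivity)
  have hg : Integrable (fun v : ℝ => 1 + v ^ 4) (gaussianReal 0 s) := by
    have h1 := (memLp_id_gaussianReal (μ := 0) (v := s) 4).integrable_norm_pow (by norm_num)
    refine (integrable_const (1 : ℝ)).add (h1.congr (ae_of_all _ fun v => ?_))
    simp [(by decide : Even 4).pow_abs]
  have hgV : Integrable (fun ω => 1 + V j ω ^ 4) P := by
    rw [← hlawV j] at hg
    exact hg.comp_measurable (hV j)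
  have hfX : Integrable (fun ω => (1 - Real.exp (-X n j ω)) ^ 2) P := by
    have h1 := h.integrable_one_sub_exp_sq hn
    rw [← h.law n hn j] at h1
    exact h1.comp_measurable (h.measurable n j)
  have hfg : IndepFun (fun ω => (1 - Real.exp (-X n j ω)) ^ 2) (fun ω => 1 + V j ω ^ 4) P :=
    (hind j).comp (φ := fun x => (1 - Real.exp (-x)) ^ 2) (ψ := fun v => 1 + v ^ 4)
      (by fun_prop) (by fun_prop)
  have hint : ∫ ω, (1 - Real.exp (-X n j ω)) ^ 2 * (1 + V j ω ^ 4) ∂P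
      = (∫ x, (1 - Real.exp (-x)) ^ 2 ∂ν n) * ∫ v, (1 + v ^ 4) ∂gaussianReal 0 s := by
    rw [hfg.integral_fun_mul_eq_mul_integral hfX.aestronglyMeasurable hgV.aestronglyMeasurable,
      ← h.law n hn j, ← hlawV j,
      integral_map (h.measurable n j).aemeasurable (by fun_prop),
      integral_map (hV j).aemeasurable (by fun_prop)]
  have hmarkov := mul_meas_ge_le_integral_of_nonneg (μ := P)
    (f := fun ω => 4 * ((1 - Real.exp (-X n j ω)) ^ 2 * (1 + V j ω ^ 4)))
    (ae_of_all _ fun ω => by positivity) ((hfg.integrable_mul hfX hgV).const_mul 4)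
    (min 1 (ε ^ 4))
  rw [integral_const_mul, hint] at hmarkov
  have hsub : P.real {ω | ε ≤ |Real.sqrt (X n j ω) * V j ω|} ≤ P.real {ω | min 1 (ε ^ 4)
      ≤ 4 * ((1 - Real.exp (-X n j ω)) ^ 2 * (1 + V j ω ^ 4))} := by
    refine ENNReal.toReal_mono (measure_ne_top _ _) (measure_mono_ae ?_)
    filter_upwards [h.ae_nonneg hn] with ω hω hmem
    exact min_one_pow_four_le_of_le_abs_sqrt_mul (hω j) hε.le hmem
  refine hsub.trans ?_
  rw [div_mul_eq_mul_div, le_div_iff₀ hmin]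
  linarith

lemma tendstoInMeasure_iSup_abs_sqrt_mul (h : IsNonnegIIDArray P X ν)
    (hV : ∀ j, Measurable (V j)) (hlawV : ∀ j, P.map (V j) = gaussianReal 0 s)
    (hind : ∀ n, 1 ≤ n → ∀ j : Fin n, IndepFun (X n j) (V j) P)
    (hsq : Tendsto (fun n : ℕ => (n : ℝ) * ∫ x, (1 - Real.exp (-x)) ^ 2 ∂ν n) atTop (𝓝 0)) :
    TendstoInMeasure P (fun (n : ℕ) (ω : Ω) => ⨆ j : Fin n, |Real.sqrt (X n j ω) * V j ω|) atTop
      (fun _ => (0 : ℝ)) := by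
  rw [tendstoInMeasure_iff_measureReal_norm]
  intro ε hε
  have hlim := hsq.const_mul (4 * (∫ v, (1 + v ^ 4) ∂gaussianReal 0 s) / min 1 (ε ^ 4))
  rw [mul_zero] at hlim
  refine squeeze_zero' (Eventually.of_forall fun n => measureReal_nonneg) ?_ hlim
  filter_upwards [eventually_ge_atTop 1] with n hn
  have hsub : {ω | ε ≤ ‖(⨆ j : Fin n, |Real.sqrt (X n j ω) * V j ω|) - 0‖}
      ⊆ ⋃ j : Fin n, {ω | ε ≤ |Real.sqrt (X n j ω) * V j ω|} := by
    intro ω hmem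
    have : Nonempty (Fin n) := ⟨⟨0, hn⟩⟩
    have hmem : ε ≤ ‖(⨆ j : Fin n, |Real.sqrt (X n j ω) * V j ω|) - 0‖ := hmem
    rw [sub_zero, Real.norm_of_nonneg (Real.iSup_nonneg fun _ => abs_nonneg _)] at hmem
    obtain ⟨j, hj⟩ :=
      exists_eq_ciSup_of_finite (f := fun j : Fin n => |Real.sqrt (X n j ω) * V j ω|)
    exact Set.mem_iUnion.2 ⟨j, hmem.trans_eq hj.symm⟩
  refine ((measureReal_mono hsub).trans (measureReal_iUnion_fin_le fun j =>
    h.measureReal_le_abs_sqrt_mul_le hV hlawV hn (hind n hn) hε j)).trans_eq ?_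
  ring

/-- A large weight occurs as soon as an entry is large and its Gaussian factor is at least `1` in
absolute value, which has a fixed positive probability. -/
lemma tendsto_mul_tail_of_tendstoInMeasure_iSup_abs_sqrt_mul (h : IsNonnegIIDArray P X ν)
    (hV : ∀ j, Measurable (V j)) (hlawV : ∀ j, P.map (V j) = gaussianReal 0 s) (hs : s ≠ 0)
    (hind : ∀ n, 1 ≤ n → iIndepFun (Sum.elim (X n) fun j : Fin n => V j) P)
    (hmax : TendstoInMeasure P
      (fun (n : ℕ) (ω : Ω) => ⨆ j : Fin n, |Real.sqrt (X n j ω) * V j ω|) atTop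
      (fun _ => (0 : ℝ))) {ε : ℝ} (hε : 0 < ε) :
    Tendsto (fun n : ℕ => (n : ℝ) * (ν n).real (Set.Ici ε)) atTop (𝓝 0) := by
  rw [tendstoInMeasure_iff_measureReal_norm] at hmax
  have hT : MeasurableSet {v : ℝ | 1 ≤ |v|} := measurableSet_le (by fun_prop) (by fun_prop)
  set c := (gaussianReal 0 s).real {v : ℝ | 1 ≤ |v|}
  have hc : 0 < c := by
    refine ENNReal.toReal_pos (fun h0 => ?_) (measure_ne_top _ _)
    have h1 := gaussianReal_absolutelyContinuous' 0 hs h0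
    have h2 : Set.Ici (1 : ℝ) ⊆ {v : ℝ | 1 ≤ |v|} := fun v hv => le_trans hv (le_abs_self v)
    simpa using measure_mono_null h2 h1
  have hmeas : ∀ n (j : Fin n),
      MeasurableSet (X n j ⁻¹' Set.Ici ε ∩ V j ⁻¹' {v : ℝ | 1 ≤ |v|}) := fun n j =>
    (h.measurable n j measurableSet_Ici).inter (hV j hT)
  have key : Tendsto (fun n : ℕ => (n : ℝ) * ((ν n).real (Set.Ici ε) * c)) atTop (𝓝 0) := by
    refine tendsto_mul_zero_of_tendsto_measureReal_iUnion hmeas ?_ ?_ ?_ (P := P)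
    · intro n hn
      exact iIndepFun.iIndepSet_preimage_inter_preimage (h.measurable n) (fun j => hV j)
        (hind n hn) measurableSet_Ici hT
    · intro n hn j
      have h1 : IndepFun (X n j) (V j) P := by
        simpa using (hind n hn).indepFun (i := Sum.inl j) (j := Sum.inr j) (by simp)
      rw [measureReal_def, h1.measure_inter_preimage_eq_mul _ _ measurableSet_Ici hT,
        ENNReal.toReal_mul, ← measureReal_def, ← measureReal_def,
        ← map_measureReal_apply (h.measurable n j) measurableSet_Ici,
        ← map_measureReal_apply (hV j) hT, h.law n hn j, hlawV j]
    · refine squeeze_zero (fun n => measureReal_nonneg) (fun n => measureReal_mono ?_)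
        (hmax (Real.sqrt ε) (Real.sqrt_pos.2 hε))
      refine Set.iUnion_subset fun j ω hω => ?_
      have h1 : |Real.sqrt (X n j ω) * V j ω| ≤ ⨆ j : Fin n, |Real.sqrt (X n j ω) * V j ω| :=
        le_ciSup (f := fun j : Fin n => |Real.sqrt (X n j ω) * V j ω|)
          (Set.finite_range _).bddAbove j
      have h2 : Real.sqrt ε ≤ Real.sqrt (X n j ω) := Real.sqrt_le_sqrt hω.1
      have h3 : 1 ≤ |V j ω| := hω.2
      have h4 : Real.sqrt ε ≤ |Real.sqrt (X n j ω) * V j ω| := by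
        rw [abs_mul, abs_of_nonneg (Real.sqrt_nonneg _)]
        nlinarith [Real.sqrt_nonneg (X n j ω)]
      simpa using (h4.trans h1).trans (le_abs_self _)
  have := key.div_const c
  rw [zero_div] at this
  refine this.congr fun n => ?_
  field_simp

end Weights

end IsNonnegIIDArray

/-! ### The network -/

/-- Hidden layer `l` can be given any width `n ≥ 1`, next to a layer `l + 1` that contains a
prescribed node `k`. -/
lemma exists_isWidthVector {L din dout l n k : ℕ} (hdin : 1 ≤ din) (hdout : 1 ≤ dout)
    (hl1 : 1 ≤ l) (hlL : l ≤ L) (hn : 1 ≤ n) (hk : l = L → k < dout) :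
    ∃ p, IsWidthVector L din dout p ∧ p l = n ∧ k < p (l + 1) := by
  refine ⟨fun i => if i = 0 then din else if i = L + 1 then dout else if i = l then n else k + 1,
    ⟨by simp, by simp, fun i _ => ?_⟩, ?_, ?_⟩
  · split_ifs <;> omega
  · simp only [if_pos]
    rw [if_neg (by omega), if_neg (by omega)]
  · simp only [Nat.add_eq_zero_iff, one_ne_zero, and_false, if_false]
    split_ifs with h1 h2
    · exact hk (by omega)
    · omega
    · omega

namespace NetParams

variable {Ω : Type*} [MeasurableSpace Ω] {P : Measure Ω} {L din dout : ℕ}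
  (N : NetParams P L din dout) {l k : ℕ}

/-- The node variances of a hidden layer are independent of each other and of the Gaussian factors
of the weights entering a given node of the next layer. -/
lemma iIndepFun_sum_elim (hl1 : 1 ≤ l) (hlL : l ≤ L) (hk : l = L → k < dout) {n : ℕ}
    (hn : 1 ≤ n) :
    iIndepFun (Sum.elim (N.lam l n) fun j : Fin n => N.V (l + 1) j k) P := by
  obtain ⟨p, hp, rfl, hpk⟩ := exists_isWidthVector N.din_pos N.dout_pos hl1 hlL hn hk
  let g : Fin (p l) ⊕ Fin (p l) → NetIndex L p :=
    Sum.elim (fun j => .nodeVar l ⟨hl1, hlL⟩ j) (fun j => .gauss l hlL j ⟨k, hpk⟩)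
  have hg : Function.Injective g := by
    rintro (i | i) (j | j) hij <;> simp_all [g]
  convert! (N.indep p hp).precomp hg using 1
  funext i
  rcases i with i | i <;> rfl

lemma indepFun_lam_V (hl1 : 1 ≤ l) (hlL : l ≤ L) (hk : l = L → k < dout) {n : ℕ}
    (hn : 1 ≤ n) (j : Fin n) : IndepFun (N.lam l n j) (N.V (l + 1) j k) P := by
  simpa using (N.iIndepFun_sum_elim hl1 hlL hk hn).indepFun (i := Sum.inl j) (j := Sum.inr j)
    (by simp)

lemma isNonnegIIDArray (hl1 : 1 ≤ l) (hlL : l ≤ L) :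
    IsNonnegIIDArray P (N.lam l) (N.nodeLaw l) where
  measurable := N.measurable_lam l
  indep n hn := by
    simpa using (N.iIndepFun_sum_elim hl1 hlL (k := 0) (fun _ => N.dout_pos) hn).precomp
      Sum.inl_injective
  law n _ := N.law_lam l n hl1 hlL
  neg_null n hn := N.nodeLaw_neg_null l n hl1 hlL hn

lemma map_V (hl1 : 1 ≤ l) (hlL : l ≤ L) (hk : l = L → k < dout) (j : ℕ) :
    P.map (N.V (l + 1) j k) = gaussianReal 0 (N.sigmaV ^ 2) := by
  obtain ⟨p, hp, hpl, hpk⟩ :=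
    exists_isWidthVector (n := j + 1) N.din_pos N.dout_pos hl1 hlL (by omega) hk
  exact N.law_V p hp l hlL j (by omega) k hpk

end NetParams

/-- The suprema over `Fin n` below are maxima over the nodes of a layer of width `n`. Nodes `k` of
layer `l + 1` are numbered from `0`; if `l = L`, that layer is the output layer, which has only the
nodes `k < dout`. -/
theorem mainTheorem3 {Ω : Type*} [MeasurableSpace Ω] (P : Measure Ω) [IsProbabilityMeasure P]
    {Ω' : Type*} [MeasurableSpace Ω'] (P' : Measure Ω') [IsProbabilityMeasure P']
    (L din dout : ℕ) (N : NetParams P L din dout)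
    (l : ℕ) (hl1 : 1 ≤ l) (hlL : l ≤ L)
    (a : ℝ) (ha : 0 ≤ a) (ρ : Measure ℝ) (hρ : IsLevyMeasure ρ)
    (S : Ω' → ℝ) (hS : IsID a ρ (P'.map S))
    (hconv : TendstoInDistribution (fun (n : ℕ) (ω : Ω) => ∑ j : Fin n, N.lam l n j ω)
      atTop S (fun _ => P) P') :
    List.TFAE [
      IsTrivialLevy ρ,
      TendstoInMeasure P (fun (n : ℕ) (ω : Ω) => ⨆ j : Fin n, N.lam l n j ω) atTop
        (fun _ => (0 : ℝ)),
      ∀ k : ℕ, (l = L → k < dout) →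
        TendstoInMeasure P (fun (n : ℕ) (ω : Ω) => ⨆ j : Fin n, |N.weight l n j k ω|) atTop
          (fun _ => (0 : ℝ))] := by
  simp only [NetParams.weight]
  have h := N.isNonnegIIDArray hl1 hlL
  tfae_have 1 → 3 := by
    intro h1 k hk
    have hsq := h.tendsto_mul_integral_one_sub_exp_sq hρ hS hconv
    rw [hρ.isTrivialLevy_iff.1 h1] at hsq
    exact h.tendstoInMeasure_iSup_abs_sqrt_mul (V := fun j => N.V (l + 1) j k)
      (fun j => N.measurable_V (l + 1) j k) (N.map_V hl1 hlL hk)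
      (fun n hn j => N.indepFun_lam_V hl1 hlL hk hn j) hsq
  tfae_have 3 → 2 := by
    intro h3
    have hk : l = L → 0 < dout := fun _ => N.dout_pos
    exact h.tendstoInMeasure_iSup fun ε hε =>
      h.tendsto_mul_tail_of_tendstoInMeasure_iSup_abs_sqrt_mul
        (V := fun j => N.V (l + 1) j 0) (fun j => N.measurable_V (l + 1) j 0)
        (N.map_V hl1 hlL hk) (pow_ne_zero 2 N.sigmaV_pos.ne')
        (fun n hn => N.iIndepFun_sum_elim hl1 hlL hk hn) (h3 0 hk) hε
  tfae_have 2 → 1 := fun h2 =>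
    h.isTrivialLevy_of_tendsto_mul_tail hρ hS hconv fun _ hε =>
      h.tendsto_mul_tail_of_tendstoInMeasure_iSup h2 hε
  tfae_finish
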